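/- Let $0<q<1$ and $\alpha\in\mathbb{R}$. Let $e_n$, $n\in\mathbb{Z}$, be the standard basis of the complex Hilbert space $\ell^2(\mathbb{Z})$, let $U$ be the forward shift, $Ue_n=e_{n+1}$, let $U^*$ be its adjoint, and let $V$ be the self-adjoint diagonal operator $Ve_n=q^{-n}e_n$ on its natural domain $\operatorname{Dom}V=\{\psi\in\ell^2(\mathbb{Z})\mid (q^{-n}\psi_n)_{n\in\mathbb{Z}}\in\ell^2(\mathbb{Z})\}$. Let $B=U+U^*+\alpha V$ be the self-adjoint operator with domain $\operatorname{Dom}V$ if $\alpha\neq 0$, and $B=U+U^*$ with domain $\ell^2(\mathbb{Z})$ if $\alpha=0$. Then $$\operatorname{spec}_{ess}(B)=[-2,2],$$ where $\operatorname{spec}_{ess}(B)$ denotes the set of all accumulation points of the spectrum of $B$ together with all eigenvalues of $B$ of infinite multiplicity. -/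

import Mathlib

open scoped ENNReal

noncomputable section

/-! ### Spectrum and essential spectrum of an unbounded operator -/

section Spectrum

variable {H : Type*} [NormedAddCommGroup H] [InnerProductSpace ℂ H]

/-- The resolvent set of an unbounded operator `T`: the `z : ℂ` for which `T - z : Dom T → H` has
an everywhere defined bounded two-sided inverse `R`. -/
def resolventSetPMap (T : H →ₗ.[ℂ] H) : Set ℂ :=
  {z | ∃ R : H →L[ℂ] H,
    (∀ y : H, ∃ h : R y ∈ T.domain, T ⟨R y, h⟩ - z • R y = y) ∧
    ∀ x : T.domain, R (T x - z • (x : H)) = x}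

/-- The spectrum of an unbounded operator. -/
def spectrumPMap (T : H →ₗ.[ℂ] H) : Set ℂ :=
  (resolventSetPMap T)ᶜ

/-- The eigenspace `Ker (T - z)`, a subspace of `Dom T`. -/
def eigenspacePMap (T : H →ₗ.[ℂ] H) (z : ℂ) : Submodule ℂ T.domain :=
  LinearMap.ker (T.toFun - z • T.domain.subtype)

/-- The essential spectrum of a self-adjoint operator: the accumulation points of the spectrum
together with the eigenvalues of infinite multiplicity. (For a self-adjoint operator the algebraic
and the geometric multiplicity of an eigenvalue coincide.) -/
def essSpectrumPMap (T : H →ₗ.[ℂ] H) : Set ℂ :=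
  {z | AccPt z (Filter.principal (spectrumPMap T)) ∨ ¬ FiniteDimensional ℂ (eigenspacePMap T z)}

end Spectrum

/-! ### The operator `B = U + U* + α V` on `ℓ²(ℤ)` -/

/-- The complex Hilbert space `ℓ²(ℤ)`. -/
abbrev EllTwoZ : Type := lp (fun _ : ℤ => ℂ) 2

theorem memlp_shift (ψ : EllTwoZ) :
    Memℓp (E := fun _ : ℤ => ℂ) (fun n => ψ (n - 1)) 2 := by
  have h := (lp.memℓp ψ).summable (by norm_num)
  exact memℓp_gen ((Equiv.subRight (1 : ℤ)).summable_iff.mpr h)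

/-- The forward shift `U`, `(U ψ) n = ψ (n - 1)`, as an isometry; thus `U e_n = e_{n+1}`. -/
def shiftIsometry : EllTwoZ →ₗᵢ[ℂ] EllTwoZ where
  toFun ψ := ⟨fun n => ψ (n - 1), memlp_shift ψ⟩
  map_add' _ _ := rfl
  map_smul' _ _ := rfl
  norm_map' ψ := by
    rw [lp.norm_eq_tsum_rpow (by norm_num), lp.norm_eq_tsum_rpow (by norm_num)]
    congr 1
    exact (Equiv.subRight (1 : ℤ)).tsum_eq (fun n => ‖ψ n‖ ^ (2 : ℝ≥0∞).toReal)

/-- The forward shift `U` as a bounded operator. -/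
def shiftOp : EllTwoZ →L[ℂ] EllTwoZ := shiftIsometry.toContinuousLinearMap

theorem shiftOp_single (n : ℤ) :
    shiftOp (lp.single 2 n (1 : ℂ)) = lp.single 2 (n + 1) (1 : ℂ) := by
  ext m
  change (lp.single 2 n (1 : ℂ) : EllTwoZ) (m - 1) = _
  simp only [lp.single_apply, Pi.single_apply]
  grind

/-- The diagonal operator `e_n ↦ d n • e_n` on its natural (maximal) domain
`{ψ ∈ ℓ²(ℤ) | (d n ψ n)ₙ ∈ ℓ²(ℤ)}`. -/
def diagOp (d : ℤ → ℝ) : EllTwoZ →ₗ.[ℂ] EllTwoZ where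
  domain :=
    { carrier := {ψ | Memℓp (E := fun _ : ℤ => ℂ) (fun n => (d n : ℂ) * ψ n) 2}
      zero_mem' := by
        change Memℓp (E := fun _ : ℤ => ℂ) (fun n => (d n : ℂ) * (0 : ℂ)) 2
        simpa using (zero_mem_ℓp' : Memℓp (fun _ : ℤ => (0 : ℂ)) 2)
      add_mem' := by
        intro a b ha hb
        have h := Memℓp.add ha hb
        refine (congrArg (fun f => Memℓp (E := fun _ : ℤ => ℂ) f 2) ?_).mpr h
        funext n
        exact mul_add (d n : ℂ) (a n) (b n)
      smul_mem' := by
        intro c a ha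
        have h := Memℓp.const_smul ha c
        refine (congrArg (fun f => Memℓp (E := fun _ : ℤ => ℂ) f 2) ?_).mpr h
        funext n
        exact mul_left_comm (d n : ℂ) c (a n) }
  toFun :=
    { toFun := fun ψ => ⟨fun n => (d n : ℂ) * (ψ : EllTwoZ) n, ψ.2⟩
      map_add' := by
        intro a b
        ext n
        exact mul_add (d n : ℂ) ((a : EllTwoZ) n) ((b : EllTwoZ) n)
      map_smul' := by
        intro c a
        ext n
        exact mul_left_comm (d n : ℂ) c ((a : EllTwoZ) n) }

/-- The operator `V`, `V e_n = q⁻ⁿ e_n`, on its natural domain. -/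
def opV (q : ℝ) : EllTwoZ →ₗ.[ℂ] EllTwoZ := diagOp fun n => q ^ (-n)

/-- The operator `α V`, with `n`-th diagonal entry `α q⁻ⁿ`, on its natural domain. For `α ≠ 0` this
is literally `α • V` on `Dom V` (see `opAlphaV_eq_smul`); for `α = 0` it is the zero operator on
all of `ℓ²(ℤ)`. -/
def opAlphaV (α q : ℝ) : EllTwoZ →ₗ.[ℂ] EllTwoZ := diagOp fun n => α * q ^ (-n)

/-- The operator `B = U + U* + α V`, with `Dom B = Dom (α V)`. -/
def opB (α q : ℝ) : EllTwoZ →ₗ.[ℂ] EllTwoZ :=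
  ((shiftOp + ContinuousLinearMap.adjoint shiftOp : EllTwoZ →L[ℂ] EllTwoZ) :
    EllTwoZ →ₗ[ℂ] EllTwoZ) +ᵥ opAlphaV α q

theorem opAlphaV_eq_smul {α : ℝ} (hα : α ≠ 0) (q : ℝ) :
    opAlphaV α q = (α : ℂ) • opV q := by
  have hα' : (α : ℂ) ≠ 0 := by exact_mod_cast hα
  refine LinearPMap.ext ?_ ?_
  · ext ψ
    constructor
    · intro h
      have h2 := Memℓp.const_smul (show Memℓp (E := fun _ : ℤ => ℂ)
        (fun n => ((α * q ^ (-n) : ℝ) : ℂ) * ψ n) 2 from h) ((α : ℂ)⁻¹)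
      refine (congrArg (fun f => Memℓp (E := fun _ : ℤ => ℂ) f 2) ?_).mpr h2
      funext n
      simp only [Pi.smul_apply, smul_eq_mul]
      push_cast
      field_simp
    · intro h
      have h2 := Memℓp.const_smul (show Memℓp (E := fun _ : ℤ => ℂ)
        (fun n => ((q ^ (-n) : ℝ) : ℂ) * ψ n) 2 from h) (α : ℂ)
      refine (congrArg (fun f => Memℓp (E := fun _ : ℤ => ℂ) f 2) ?_).mpr h2
      funext n
      simp only [Pi.smul_apply, smul_eq_mul]
      push_cast
      ring
  · intro ψ h1 h2
    ext n
    change ((α * q ^ (-n) : ℝ) : ℂ) * ψ n = (α : ℂ) * (((q ^ (-n) : ℝ) : ℂ) * ψ n)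
    push_cast
    ring

end

noncomputable section

open Filter Topology ComplexConjugate

/-! ### Jacobi operators with unit weights on `ℓ²(ℤ)` -/

/-! The theorem reflects that only the free part at `-∞` contributes: the potential `d n = α q⁻ⁿ`
vanishes at `-∞` and, for `α ≠ 0`, has `|d n| → ∞` at `+∞`.

The spectrum contains `[-2,2]`: truncated plane waves placed far to the left are approximate
eigenvectors for `a + a⁻¹ = 2 cos θ` (`add_inv_mem_spectrumPMap_jacobiOp`). A nondegenerate interval
has no isolated point, so all its points are accumulation points.

Conversely, the spectrum is real by symmetry. For real `|t| > 2` one has `|d n - t| ≥ 2 + c` off a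
finite set. As `‖U + U*‖ ≤ 2`, a finite-rank diagonal correction makes `T - t` bounded below, which
excludes accumulation at `t` (`not_accPt_spectrumPMap_jacobiOp`). Infinite multiplicity is
impossible because the eigenvalue equation is a second-order recurrence. -/

/-- The bounded operator `U + U*`. -/
def hopOp : EllTwoZ →L[ℂ] EllTwoZ := shiftOp + ContinuousLinearMap.adjoint shiftOp

/-- The Jacobi operator `U + U* + diag d`, on the natural domain of `diag d`. -/
def jacobiOp (d : ℤ → ℝ) : EllTwoZ →ₗ.[ℂ] EllTwoZ :=
  (hopOp : EllTwoZ →ₗ[ℂ] EllTwoZ) +ᵥ diagOp d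

theorem opB_eq_jacobiOp (α q : ℝ) : opB α q = jacobiOp fun n => α * q ^ (-n) := rfl

theorem shiftOp_apply (ψ : EllTwoZ) (n : ℤ) : shiftOp ψ n = ψ (n - 1) := rfl

theorem adjoint_shiftOp_apply (ψ : EllTwoZ) (n : ℤ) :
    ContinuousLinearMap.adjoint shiftOp ψ n = ψ (n + 1) := by
  have h := ContinuousLinearMap.adjoint_inner_right shiftOp (lp.single 2 n (1 : ℂ)) ψ
  rw [shiftOp_single, lp.inner_single_left, lp.inner_single_left] at h
  simpa using h

theorem hopOp_apply (ψ : EllTwoZ) (n : ℤ) : hopOp ψ n = ψ (n - 1) + ψ (n + 1) := by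
  change shiftOp ψ n + ContinuousLinearMap.adjoint shiftOp ψ n = _
  rw [shiftOp_apply, adjoint_shiftOp_apply]

theorem hopOp_single (n : ℤ) (a : ℂ) :
    hopOp (lp.single 2 n a) = lp.single 2 (n + 1) a + lp.single 2 (n - 1) a := by
  ext m
  rw [hopOp_apply]
  change Pi.single (M := fun _ => ℂ) n a (m - 1) + Pi.single (M := fun _ => ℂ) n a (m + 1) =
    Pi.single (M := fun _ => ℂ) (n + 1) a m + Pi.single (M := fun _ => ℂ) (n - 1) a m
  simp only [Pi.single_apply]
  grind

theorem norm_hopOp_le : ‖hopOp‖ ≤ 2 := by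
  have h : ‖shiftOp‖ ≤ 1 := shiftIsometry.norm_toContinuousLinearMap_le
  have h' : ‖ContinuousLinearMap.adjoint shiftOp‖ ≤ 1 := by
    rwa [LinearIsometryEquiv.norm_map]
  exact (norm_add_le _ _).trans (by linarith)

theorem norm_hopOp_apply_le (ψ : EllTwoZ) : ‖hopOp ψ‖ ≤ 2 * ‖ψ‖ :=
  (hopOp.le_opNorm ψ).trans (by gcongr; exact norm_hopOp_le)

theorem inner_hopOp (x y : EllTwoZ) : inner ℂ (hopOp x) y = inner ℂ x (hopOp y) := by
  simp only [hopOp, _root_.add_apply, inner_add_left, inner_add_right,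
    ContinuousLinearMap.adjoint_inner_left, ContinuousLinearMap.adjoint_inner_right]
  exact add_comm _ _

section

variable {d : ℤ → ℝ}

/-! ### Domain, symmetry and closedness. -/

theorem mem_jacobiOp_domain {x : EllTwoZ} (y : EllTwoZ) (h : ∀ n, y n = (d n : ℂ) * x n) :
    x ∈ (jacobiOp d).domain := by
  change Memℓp (E := fun _ : ℤ => ℂ) (fun n => (d n : ℂ) * x n) 2
  rw [← funext h]
  exact lp.memℓp y

theorem jacobiOp_eq (x : (jacobiOp d).domain) :
    jacobiOp d x = hopOp (x : EllTwoZ) + diagOp d x := rfl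

theorem jacobiOp_apply (x : (jacobiOp d).domain) (n : ℤ) :
    jacobiOp d x n =
      (x : EllTwoZ) (n - 1) + (x : EllTwoZ) (n + 1) + (d n : ℂ) * (x : EllTwoZ) n := by
  rw [jacobiOp_eq, lp.coeFn_add, Pi.add_apply, hopOp_apply]
  rfl

theorem single_mem_jacobiOp_domain (n : ℤ) (a : ℂ) :
    (lp.single 2 n a : EllTwoZ) ∈ (jacobiOp d).domain := by
  refine mem_jacobiOp_domain (lp.single 2 n (d n * a)) fun m => ?_
  simp only [lp.single_apply, Pi.single_apply]
  split_ifs with h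
  · rw [h]
  · simp

theorem jacobiOp_single (n : ℤ) (a : ℂ) :
    jacobiOp d ⟨lp.single 2 n a, single_mem_jacobiOp_domain n a⟩ =
      hopOp (lp.single 2 n a) + lp.single 2 n (d n * a) := by
  ext m
  rw [jacobiOp_apply, lp.coeFn_add, Pi.add_apply, hopOp_apply]
  simp only [lp.single_apply, Pi.single_apply]
  split_ifs <;> simp_all

/-- Jacobi operators are symmetric. -/
theorem inner_jacobiOp (x y : (jacobiOp d).domain) :
    inner ℂ (jacobiOp d x) (y : EllTwoZ) = inner ℂ (x : EllTwoZ) (jacobiOp d y) := by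
  rw [jacobiOp_eq, jacobiOp_eq, inner_add_left, inner_add_right, inner_hopOp]
  congr 1
  rw [lp.inner_eq_tsum, lp.inner_eq_tsum]
  refine tsum_congr fun n => ?_
  change inner ℂ ((d n : ℂ) * (x : EllTwoZ) n) ((y : EllTwoZ) n) =
    inner ℂ ((x : EllTwoZ) n) ((d n : ℂ) * (y : EllTwoZ) n)
  simp only [RCLike.inner_apply, map_mul, Complex.conj_ofReal]
  ring

theorem tendsto_apply {ι : Type*} {l : Filter ι} {u : ι → EllTwoZ} {x : EllTwoZ}
    (h : Tendsto u l (𝓝 x)) (n : ℤ) : Tendsto (fun k => u k n) l (𝓝 (x n)) :=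
  ((lp.evalCLM ℂ (fun _ : ℤ => ℂ) 2 n).continuous.tendsto x).comp h

/-- Jacobi operators are closed. -/
theorem jacobiOp_closed {u : ℕ → (jacobiOp d).domain} {x y : EllTwoZ}
    (hx : Tendsto (fun k => (u k : EllTwoZ)) atTop (𝓝 x))
    (hy : Tendsto (fun k => jacobiOp d (u k)) atTop (𝓝 y)) :
    ∃ h : x ∈ (jacobiOp d).domain, jacobiOp d ⟨x, h⟩ = y := by
  have key : ∀ n, y n = x (n - 1) + x (n + 1) + (d n : ℂ) * x n := by
    intro n
    refine tendsto_nhds_unique (tendsto_apply hy n) ?_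
    simp only [jacobiOp_apply]
    exact ((tendsto_apply hx _).add (tendsto_apply hx _)).add ((tendsto_apply hx n).const_mul _)
  have hmem : x ∈ (jacobiOp d).domain := by
    refine mem_jacobiOp_domain (y - hopOp x) fun n => ?_
    rw [lp.coeFn_sub, Pi.sub_apply, hopOp_apply, key]
    ring
  refine ⟨hmem, ?_⟩
  ext n
  rw [jacobiOp_apply, key]

/-! ### Resolvent criterion, real spectrum, approximate eigenvectors. -/

/-- The orthogonal complement of the range of `T - z` consists of eigenvectors for `conj z`. -/
theorem jacobiOp_adjoint_eigenvector {z : ℂ} {y : EllTwoZ}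
    (h : ∀ x : (jacobiOp d).domain, inner ℂ (jacobiOp d x - z • (x : EllTwoZ)) y = 0) :
    ∃ hy : y ∈ (jacobiOp d).domain, jacobiOp d ⟨y, hy⟩ = conj z • y := by
  have key : ∀ n, y (n - 1) + y (n + 1) + (d n : ℂ) * y n = conj z * y n := by
    intro n
    have h1 := h ⟨_, single_mem_jacobiOp_domain n 1⟩
    rw [jacobiOp_single, inner_sub_left, inner_add_left, hopOp_single, inner_add_left,
      inner_smul_left] at h1
    simp only [lp.inner_single_left, RCLike.inner_apply, map_one, mul_one,
      Complex.conj_ofReal] at h1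
    linear_combination h1
  have hmem : y ∈ (jacobiOp d).domain := by
    refine mem_jacobiOp_domain (conj z • y - hopOp y) fun n => ?_
    rw [lp.coeFn_sub, Pi.sub_apply, hopOp_apply, lp.coeFn_smul, Pi.smul_apply, smul_eq_mul]
    linear_combination -key n
  refine ⟨hmem, ?_⟩
  ext n
  rw [jacobiOp_apply, lp.coeFn_smul, Pi.smul_apply, smul_eq_mul]
  exact key n

/-- If `T - z` is bounded below and `conj z` is not an eigenvalue, `z` is in the resolvent set. -/
theorem mem_resolventSetPMap_jacobiOp {z : ℂ} {c : ℝ} (hc : 0 < c)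
    (hbelow : ∀ x : (jacobiOp d).domain,
      c * ‖(x : EllTwoZ)‖ ≤ ‖jacobiOp d x - z • (x : EllTwoZ)‖)
    (hker : ∀ x : (jacobiOp d).domain, jacobiOp d x = conj z • (x : EllTwoZ) →
      (x : EllTwoZ) = 0) :
    z ∈ resolventSetPMap (jacobiOp d) := by
  let S : (jacobiOp d).domain →ₗ[ℂ] EllTwoZ :=
    (jacobiOp d).toFun - z • (jacobiOp d).domain.subtype
  have hS : ∀ x, S x = jacobiOp d x - z • (x : EllTwoZ) := fun x => rfl
  have hinj : Function.Injective S := by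
    refine (injective_iff_map_eq_zero S).mpr fun x hx => ?_
    have h1 := hbelow x
    rw [← hS, hx, norm_zero] at h1
    have h2 : ‖(x : EllTwoZ)‖ ≤ 0 := by
      by_contra! h3
      linarith [mul_pos hc h3]
    exact Subtype.ext (norm_le_zero_iff.mp h2)
  -- The lower bound turns convergent images into Cauchy preimages; closedness of `T` then puts the
  -- limit in the range.
  have hclosed : IsClosed (LinearMap.range S : Set EllTwoZ) := by
    refine isClosed_of_closure_subset fun y hy => ?_
    obtain ⟨v, hv, hvy⟩ := mem_closure_iff_seq_limit.mp hy
    choose u hu using hv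
    have hcau : CauchySeq fun k => (u k : EllTwoZ) := by
      refine Metric.cauchySeq_iff'.mpr fun ε hε => ?_
      obtain ⟨N, hN⟩ := Metric.cauchySeq_iff'.mp hvy.cauchySeq (c * ε) (mul_pos hc hε)
      refine ⟨N, fun n hn => ?_⟩
      have h1 := hbelow (u n - u N)
      rw [← hS, map_sub, hu, hu, ← dist_eq_norm] at h1
      rw [dist_eq_norm]
      exact lt_of_mul_lt_mul_left (h1.trans_lt (hN n hn)) hc.le
    obtain ⟨x, hx⟩ := cauchySeq_tendsto_of_complete hcau
    have hT : Tendsto (fun k => jacobiOp d (u k)) atTop (𝓝 (y + z • x)) := by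
      refine (hvy.add (hx.const_smul z)).congr fun k => ?_
      rw [← hu k, hS]
      abel
    obtain ⟨hmem, hxy⟩ := jacobiOp_closed hx hT
    refine ⟨⟨x, hmem⟩, ?_⟩
    rw [hS, hxy]
    simp
  have hsurj : LinearMap.range S = ⊤ := by
    -- A closed range is everything once its orthogonal complement, made of eigenvectors for `conj
    -- z`, is trivial.
    have : CompleteSpace (LinearMap.range S) := hclosed.completeSpace_coe
    rw [← Submodule.orthogonal_eq_bot_iff, Submodule.eq_bot_iff]
    intro y hy
    obtain ⟨hmem, hxy⟩ := jacobiOp_adjoint_eigenvector (d := d) (z := z) (y := y) fun x =>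
      (Submodule.mem_orthogonal _ _).mp hy _ ⟨x, rfl⟩
    exact hker ⟨y, hmem⟩ hxy
  let e := LinearEquiv.ofBijective S ⟨hinj, LinearMap.range_eq_top.mp hsurj⟩
  have he : ∀ x, e x = jacobiOp d x - z • (x : EllTwoZ) := fun x => rfl
  refine ⟨((jacobiOp d).domain.subtype ∘ₗ e.symm.toLinearMap).mkContinuous c⁻¹ fun y => ?_,
    fun y => ⟨(e.symm y).2, ?_⟩, fun x => ?_⟩
  · have h1 := hbelow (e.symm y)
    rw [← he, e.apply_symm_apply] at h1
    rwa [le_inv_mul_iff₀ hc]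
  · exact e.apply_symm_apply y
  · exact congrArg Subtype.val (e.symm_apply_apply x)

theorem im_inner_jacobiOp_sub (z : ℂ) (x : (jacobiOp d).domain) :
    (inner ℂ (x : EllTwoZ) (jacobiOp d x - z • (x : EllTwoZ))).im =
      -z.im * ‖(x : EllTwoZ)‖ ^ 2 := by
  have h1 : (inner ℂ (x : EllTwoZ) (jacobiOp d x)).im = 0 := by
    rw [← Complex.conj_eq_iff_im, inner_conj_symm, inner_jacobiOp]
  rw [inner_sub_right, inner_smul_right, Complex.sub_im, h1, inner_self_eq_norm_sq_to_K]
  simp [← Complex.ofReal_pow]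

/-- By symmetry `⟨x, T x⟩` is real, so `⟨x, (T - z) x⟩` has imaginary part `-Im z ‖x‖²`;
Cauchy–Schwarz concludes. -/
theorem abs_im_mul_norm_le (z : ℂ) (x : (jacobiOp d).domain) :
    |z.im| * ‖(x : EllTwoZ)‖ ≤ ‖jacobiOp d x - z • (x : EllTwoZ)‖ := by
  rcases eq_or_ne (x : EllTwoZ) 0 with h | h
  · rw [h, norm_zero, mul_zero]
    exact norm_nonneg _
  · have h1 := (Complex.abs_im_le_norm _).trans (norm_inner_le_norm (𝕜 := ℂ) (x : EllTwoZ)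
      (jacobiOp d x - z • (x : EllTwoZ)))
    rw [im_inner_jacobiOp_sub, abs_mul, abs_neg, abs_of_nonneg (sq_nonneg ‖(x : EllTwoZ)‖)] at h1
    have h2 : 0 < ‖(x : EllTwoZ)‖ := norm_pos_iff.mpr h
    nlinarith

theorem eq_zero_of_jacobiOp_eq_smul {z : ℂ} (hz : z.im ≠ 0) {x : (jacobiOp d).domain}
    (hx : jacobiOp d x = z • (x : EllTwoZ)) : (x : EllTwoZ) = 0 := by
  have h := abs_im_mul_norm_le z x
  rw [hx, sub_self, norm_zero] at h
  have h2 := abs_pos.mpr hz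
  by_contra h3
  linarith [mul_pos h2 (norm_pos_iff.mpr h3)]

theorem im_eq_zero_of_mem_spectrumPMap_jacobiOp {z : ℂ} (hz : z ∈ spectrumPMap (jacobiOp d)) :
    z.im = 0 := by
  by_contra h
  exact hz (mem_resolventSetPMap_jacobiOp (abs_pos.mpr h) (abs_im_mul_norm_le z) fun x hx =>
    eq_zero_of_jacobiOp_eq_smul (by simpa using h) hx)

/-- Points of the spectrum are approximate eigenvalues. -/
theorem exists_approx_eigenvector {z : ℂ} (hz : z ∈ spectrumPMap (jacobiOp d)) {ε : ℝ}
    (hε : 0 < ε) :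
    ∃ x : (jacobiOp d).domain, ‖(x : EllTwoZ)‖ = 1 ∧
      ‖jacobiOp d x - z • (x : EllTwoZ)‖ ≤ ε := by
  by_contra! hcon
  have hbelow : ∀ x : (jacobiOp d).domain,
      ε * ‖(x : EllTwoZ)‖ ≤ ‖jacobiOp d x - z • (x : EllTwoZ)‖ := by
    intro x
    rcases eq_or_ne (x : EllTwoZ) 0 with h | h
    · rw [h, norm_zero, mul_zero]
      exact norm_nonneg _
    · have h1 := hcon (((‖(x : EllTwoZ)‖⁻¹ : ℝ) : ℂ) • x) (by
        rw [Submodule.coe_smul, norm_smul, Complex.norm_real, norm_inv, norm_norm,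
          inv_mul_cancel₀ (norm_ne_zero_iff.mpr h)])
      rw [LinearPMap.map_smul, Submodule.coe_smul, smul_comm z, ← smul_sub, norm_smul,
        Complex.norm_real, norm_inv, norm_norm, lt_inv_mul_iff₀ (norm_pos_iff.mpr h),
        mul_comm] at h1
      exact h1.le
  have hconj : conj z = z :=
    Complex.conj_eq_iff_im.mpr (im_eq_zero_of_mem_spectrumPMap_jacobiOp hz)
  refine hz (mem_resolventSetPMap_jacobiOp hε hbelow fun x hx => ?_)
  have h := hbelow x
  rw [hx, hconj, sub_self, norm_zero] at h
  by_contra h3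
  linarith [mul_pos hε (norm_pos_iff.mpr h3)]

/-! ### Compact diagonal perturbations and isolation of spectrum outside `[-2,2]`. -/

/-- The diagonal operator with entries `b n` for `n ∈ F` and `0` elsewhere. -/
def finiteDiag (F : Finset ℤ) (b : ℤ → ℂ) : EllTwoZ →L[ℂ] EllTwoZ :=
  ∑ n ∈ F, b n • (lp.singleContinuousLinearMap ℂ (fun _ : ℤ => ℂ) 2 n).comp
    (lp.evalCLM ℂ (fun _ : ℤ => ℂ) 2 n)

theorem finiteDiag_apply (F : Finset ℤ) (b : ℤ → ℂ) (x : EllTwoZ) (n : ℤ) :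
    finiteDiag F b x n = if n ∈ F then b n * x n else 0 := by
  have h : finiteDiag F b x = ∑ m ∈ F, b m • (lp.single 2 m (x m) : EllTwoZ) := by
    rw [finiteDiag, _root_.sum_apply]
    rfl
  rw [h, lp.coeFn_sum, Finset.sum_apply]
  simp [lp.coeFn_smul, lp.single_apply, Pi.single_apply]

theorem isCompactOperator_finiteDiag (F : Finset ℤ) (b : ℤ → ℂ) :
    IsCompactOperator (finiteDiag F b) := by
  change finiteDiag F b ∈ compactOperator (RingHom.id ℂ) EllTwoZ EllTwoZ
  refine Submodule.sum_mem _ fun n _ => Submodule.smul_mem _ _ ?_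
  have h : IsCompactOperator (lp.singleContinuousLinearMap ℂ (fun _ : ℤ => ℂ) 2 n) :=
    isCompactOperator_of_locallyCompactSpace_rng (M₂ := ℂ) _
  exact h.comp_clm (lp.evalCLM ℂ (fun _ : ℤ => ℂ) 2 n)

/-- If `|d n - t| ≥ 2 + c` off a finite set then `T - t` is bounded below by `c` after adding a
finite diagonal operator. -/
theorem exists_finiteDiag_bounded_below {t c : ℝ} (hc : 0 ≤ c) {F : Finset ℤ}
    (hF : ∀ n ∉ F, 2 + c ≤ |d n - t|) :
    ∃ b : ℤ → ℂ, ∀ x : (jacobiOp d).domain,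
      c * ‖(x : EllTwoZ)‖ ≤
        ‖jacobiOp d x - (t : ℂ) • (x : EllTwoZ) + finiteDiag F b (x : EllTwoZ)‖ := by
  -- On `F` the correction replaces the diagonal entry `d n - t` by `2 + c`.
  refine ⟨fun n => ((2 + c - (d n - t) : ℝ) : ℂ), fun x => ?_⟩
  set K := finiteDiag F fun n => ((2 + c - (d n - t) : ℝ) : ℂ)
  have h1 : ‖((2 + c : ℝ) : ℂ) • (x : EllTwoZ)‖ ≤
      ‖jacobiOp d x - (t : ℂ) • (x : EllTwoZ) + K x - hopOp (x : EllTwoZ)‖ := by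
    refine lp.norm_mono (by norm_num) fun n => ?_
    have h2 : (jacobiOp d x - (t : ℂ) • (x : EllTwoZ) + K x - hopOp (x : EllTwoZ) : EllTwoZ) n =
        (d n - t) * (x : EllTwoZ) n + K x n := by
      simp only [lp.coeFn_sub, lp.coeFn_add, lp.coeFn_smul, Pi.sub_apply, Pi.add_apply,
        Pi.smul_apply, smul_eq_mul]
      rw [jacobiOp_apply, hopOp_apply]
      ring
    rw [h2, finiteDiag_apply, lp.coeFn_smul, Pi.smul_apply, smul_eq_mul]
    split_ifs with hn
    · refine (congrArg norm ?_).le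
      push_cast
      ring
    · rw [add_zero, norm_mul, norm_mul, ← Complex.ofReal_sub, Complex.norm_real, Complex.norm_real,
        Real.norm_of_nonneg (by linarith : 0 ≤ 2 + c), Real.norm_eq_abs]
      gcongr
      exact hF n hn
  rw [norm_smul, Complex.norm_real, Real.norm_of_nonneg (by linarith : 0 ≤ 2 + c)] at h1
  have h3 := norm_sub_le (jacobiOp d x - (t : ℂ) • (x : EllTwoZ) + K x) (hopOp (x : EllTwoZ))
  have h4 := norm_hopOp_apply_le (x : EllTwoZ)
  linarith

/-- Approximate eigenvectors for spectral points `z k → t` would subconverge, by compactness of the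
correction, to a unit eigenvector `x` for `t`. Symmetry makes them asymptotically orthogonal to `x`,
a contradiction. -/
theorem not_accPt_spectrumPMap_jacobiOp {t c : ℝ} (hc : 0 < c) {F : Finset ℤ}
    (hF : ∀ n ∉ F, 2 + c ≤ |d n - t|) :
    ¬ AccPt (t : ℂ) (𝓟 (spectrumPMap (jacobiOp d))) := by
  intro hacc
  obtain ⟨b, hb⟩ := exists_finiteDiag_bounded_below hc.le hF
  rw [accPt_iff_nhds] at hacc
  have hseq : ∀ k : ℕ, ∃ z : ℂ, dist z t < 1 / ((k : ℝ) + 1) ∧ z ∈ spectrumPMap (jacobiOp d) ∧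
      z ≠ t := by
    intro k
    obtain ⟨z, ⟨h1, h2⟩, h3⟩ := hacc _ (Metric.ball_mem_nhds (t : ℂ) Nat.one_div_pos_of_nat)
    exact ⟨z, h1, h2, h3⟩
  choose z hzt hzs hz using hseq
  have hpos : ∀ k, 0 < ‖z k - t‖ := fun k => norm_pos_iff.mpr (sub_ne_zero.mpr (hz k))
  -- The factor `‖z k - t‖` in the tolerance survives the division by `z k - t` in `hsmall`.
  choose u hu1 hu using fun k => exists_approx_eigenvector (hzs k)
    (mul_pos (hpos k) (Nat.one_div_pos_of_nat (α := ℝ) (n := k)))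
  have hdecay : Tendsto (fun k : ℕ => 1 / ((k : ℝ) + 1)) atTop (𝓝 0) :=
    tendsto_one_div_add_atTop_nhds_zero_nat
  have hres : Tendsto (fun k => jacobiOp d (u k) - (t : ℂ) • (u k : EllTwoZ)) atTop (𝓝 0) := by
    refine squeeze_zero_norm (a := fun k : ℕ => 1 / ((k : ℝ) + 1) + 1 / ((k : ℝ) + 1))
      (fun k => ?_) (by simpa using hdecay.add hdecay)
    have h1 : jacobiOp d (u k) - (t : ℂ) • (u k : EllTwoZ) =
        (jacobiOp d (u k) - z k • (u k : EllTwoZ)) + (z k - t) • (u k : EllTwoZ) := by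
      rw [sub_smul]
      abel
    have h2 : ‖z k - t‖ < 1 / ((k : ℝ) + 1) := by
      rw [← dist_eq_norm]
      exact hzt k
    have h3 : 1 / ((k : ℝ) + 1) ≤ 1 := by
      rw [div_le_one (by positivity)]
      linarith [(Nat.cast_nonneg k : (0 : ℝ) ≤ k)]
    have h4 : ‖z k - t‖ * (1 / ((k : ℝ) + 1)) ≤ 1 / ((k : ℝ) + 1) := by
      have : 0 < 1 / ((k : ℝ) + 1) := Nat.one_div_pos_of_nat
      nlinarith
    rw [h1]
    refine (norm_add_le _ _).trans (add_le_add ((hu k).trans h4) ?_)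
    rw [norm_smul, hu1, mul_one]
    exact h2.le
  obtain ⟨y, -, φ, hφ, hy⟩ := ((isCompactOperator_finiteDiag F b).isCompact_closure_image_closedBall
    (𝕜₁ := ℂ) (f := (finiteDiag F b : EllTwoZ →ₗ[ℂ] EllTwoZ)) 1).tendsto_subseq
      (x := fun k => finiteDiag F b (u k))
      fun k => subset_closure ⟨u k, by simp [hu1], rfl⟩
  have hlim : Tendsto (fun k => jacobiOp d (u (φ k)) - (t : ℂ) • (u (φ k) : EllTwoZ) +
      finiteDiag F b (u (φ k))) atTop (𝓝 (0 + y)) :=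
    (hres.comp hφ.tendsto_atTop).add hy
  -- The corrected operator is bounded below, so convergence of its values along `φ` forces that of
  -- the vectors.
  have hcau : CauchySeq fun k => (u (φ k) : EllTwoZ) := by
    refine Metric.cauchySeq_iff'.mpr fun ε hε => ?_
    obtain ⟨N, hN⟩ := Metric.cauchySeq_iff'.mp hlim.cauchySeq (c * ε) (mul_pos hc hε)
    refine ⟨N, fun n hn => ?_⟩
    have h1 := hb (u (φ n) - u (φ N))
    have h2 := hN n hn
    rw [dist_eq_norm] at h2 ⊢
    refine lt_of_mul_lt_mul_left (h1.trans_lt (lt_of_eq_of_lt (congrArg norm ?_) h2)) hc.le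
    rw [LinearPMap.map_sub, Submodule.coe_sub, map_sub, smul_sub]
    abel
  obtain ⟨x, hx⟩ := cauchySeq_tendsto_of_complete hcau
  have hT : Tendsto (fun k => jacobiOp d (u (φ k))) atTop (𝓝 (0 + (t : ℂ) • x)) := by
    refine ((hres.comp hφ.tendsto_atTop).add (hx.const_smul (t : ℂ))).congr fun k => ?_
    simp
  obtain ⟨hmem, hTx⟩ := jacobiOp_closed hx hT
  rw [zero_add] at hTx
  have hx1 : ‖x‖ = 1 := by
    refine tendsto_nhds_unique hx.norm ?_
    simp [hu1]
  have hinner : Tendsto (fun k => inner ℂ x (u (φ k) : EllTwoZ)) atTop (𝓝 (inner ℂ x x)) :=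
    tendsto_const_nhds.inner hx
  have hsmall : ∀ k, ‖inner ℂ x (u k : EllTwoZ)‖ ≤ 1 / ((k : ℝ) + 1) := by
    intro k
    have h1 : inner ℂ x (jacobiOp d (u k) - z k • (u k : EllTwoZ)) =
        -((z k - t) * inner ℂ x (u k : EllTwoZ)) := by
      rw [inner_sub_right, ← inner_jacobiOp ⟨x, hmem⟩ (u k), hTx, inner_smul_left,
        inner_smul_right, Complex.conj_ofReal]
      ring
    have h2 := norm_inner_le_norm (𝕜 := ℂ) x (jacobiOp d (u k) - z k • (u k : EllTwoZ))
    rw [h1, norm_neg, norm_mul, hx1, one_mul] at h2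
    exact le_of_mul_le_mul_left (h2.trans (hu k)) (hpos k)
  have h0 : Tendsto (fun k => inner ℂ x (u (φ k) : EllTwoZ)) atTop (𝓝 0) :=
    squeeze_zero_norm (fun k => hsmall (φ k)) (hdecay.comp hφ.tendsto_atTop)
  have h1 := tendsto_nhds_unique hinner h0
  rw [inner_self_eq_zero] at h1
  simp [h1] at hx1

/-! ### Multiplicity of eigenvalues. -/

/-- Eigenspaces of Jacobi operators have dimension at most two. -/
theorem finiteDimensional_eigenspacePMap_jacobiOp (z : ℂ) :
    FiniteDimensional ℂ (eigenspacePMap (jacobiOp d) z) := by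
  let f : EllTwoZ →ₗ[ℂ] ℂ × ℂ :=
    ((lp.evalCLM ℂ (fun _ : ℤ => ℂ) 2 0 : EllTwoZ →L[ℂ] ℂ) : EllTwoZ →ₗ[ℂ] ℂ).prod
      ((lp.evalCLM ℂ (fun _ : ℤ => ℂ) 2 1 : EllTwoZ →L[ℂ] ℂ) : EllTwoZ →ₗ[ℂ] ℂ)
  refine Module.Finite.of_injective
    (f ∘ₗ (jacobiOp d).domain.subtype ∘ₗ (eigenspacePMap (jacobiOp d) z).subtype) ?_
  refine (injective_iff_map_eq_zero _).mpr ?_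
  rintro ⟨x, hx⟩ hfx
  have hrec : ∀ n, (x : EllTwoZ) (n - 1) + (x : EllTwoZ) (n + 1) + (d n : ℂ) * (x : EllTwoZ) n =
      z * (x : EllTwoZ) n := by
    intro n
    have h1 : jacobiOp d x = z • (x : EllTwoZ) := sub_eq_zero.mp (LinearMap.mem_ker.mp hx)
    rw [← jacobiOp_apply, h1]
    rfl
  have h0 : (x : EllTwoZ) 0 = 0 ∧ (x : EllTwoZ) (0 + 1) = 0 := Prod.ext_iff.mp hfx
  -- Two adjacent zeros propagate through the recurrence in both directions.
  have hall : ∀ n : ℤ, (x : EllTwoZ) n = 0 ∧ (x : EllTwoZ) (n + 1) = 0 := by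
    intro n
    induction n with
    | zero => exact h0
    | succ k ih =>
      have h1 := hrec (k + 1)
      rw [add_sub_cancel_right, ih.1, ih.2] at h1
      exact ⟨ih.2, by simpa using h1⟩
    | pred k ih =>
      have h1 := hrec (-k)
      rw [ih.1, ih.2] at h1
      exact ⟨by simpa using h1, by rw [sub_add_cancel]; exact ih.1⟩
  refine Subtype.ext (Subtype.ext ?_)
  ext n
  exact (hall n).1

/-! ### Plane waves and the inclusion of `[-2,2]` in the spectrum. -/

/-- The truncated plane wave `∑ₖ aᵏ e_{m-k}`, `0 ≤ k < N`. -/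
def planeWave (a : ℂ) (m : ℤ) (N : ℕ) : EllTwoZ :=
  ∑ k ∈ Finset.range N, lp.single 2 (m - k) (a ^ (k : ℤ))

theorem norm_planeWave {a : ℂ} (ha : ‖a‖ = 1) (m : ℤ) (N : ℕ) :
    ‖planeWave a m N‖ ^ 2 = N := by
  let e : ℕ ↪ ℤ := ⟨fun k => m - k, fun i j h => by simpa using h⟩
  have h1 : planeWave a m N =
      ∑ n ∈ (Finset.range N).map e, lp.single 2 n (a ^ (m - n)) := by
    rw [Finset.sum_map]
    refine Finset.sum_congr rfl fun k _ => ?_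
    change _ = lp.single (E := fun _ : ℤ => ℂ) 2 (m - (k : ℤ)) (a ^ (m - (m - (k : ℤ))))
    rw [sub_sub_cancel]
  have h2 := lp.norm_sum_single (E := fun _ : ℤ => ℂ) (p := 2) (by norm_num)
    (fun n => a ^ (m - n)) ((Finset.range N).map e)
  rw [← h1] at h2
  simpa [ha] using h2

theorem planeWave_apply_eq_zero (a : ℂ) {m : ℤ} (N : ℕ) {n : ℤ} (hn : m < n) :
    planeWave a m N n = 0 := by
  rw [planeWave, lp.coeFn_sum, Finset.sum_apply]
  refine Finset.sum_eq_zero fun k _ => ?_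
  exact lp.single_apply_ne 2 _ _ (by omega)

theorem planeWave_mem_domain (a : ℂ) (m : ℤ) (N : ℕ) :
    planeWave a m N ∈ (jacobiOp d).domain :=
  Submodule.sum_mem _ fun _ _ => single_mem_jacobiOp_domain _ _

/-- An untruncated plane wave solves the equation exactly, so only boundary terms remain, bounded
independently of `N` while `‖planeWave a m N‖ = √N` grows. -/
theorem norm_hopOp_planeWave_sub_le {a : ℂ} (ha : ‖a‖ = 1) (m : ℤ) (N : ℕ) :
    ‖hopOp (planeWave a m N) - (a + a⁻¹) • planeWave a m N‖ ≤ 4 := by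
  have ha0 : a ≠ 0 := norm_ne_zero_iff.mp (by rw [ha]; norm_num)
  -- Chosen so that `g (k + 1) - g k` is the error of the `k`-th summand; the sum telescopes.
  let g : ℕ → EllTwoZ := fun k => lp.single 2 (m - k) (a ^ ((k : ℤ) - 1)) -
    lp.single 2 (m - k + 1) (a ^ (k : ℤ))
  have hg : ∀ k, ‖g k‖ ≤ 2 := fun k => by
    refine (norm_sub_le _ _).trans ?_
    rw [lp.norm_single (by norm_num), lp.norm_single (by norm_num), norm_zpow, norm_zpow, ha]
    norm_num
  have h : hopOp (planeWave a m N) - (a + a⁻¹) • planeWave a m N = g N - g 0 := by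
    rw [← Finset.sum_range_sub, planeWave, map_sum, Finset.smul_sum, ← Finset.sum_sub_distrib]
    refine Finset.sum_congr rfl fun k _ => ?_
    have h1 : m - ((k + 1 : ℕ) : ℤ) = m - k - 1 := by push_cast; ring
    have h2 : ((k + 1 : ℕ) : ℤ) - 1 = k := by push_cast; ring
    have h3 : (a + a⁻¹) • (lp.single 2 (m - k) (a ^ (k : ℤ)) : EllTwoZ) =
        lp.single 2 (m - k) (a ^ ((k + 1 : ℕ) : ℤ)) + lp.single 2 (m - k) (a ^ ((k : ℤ) - 1)) := by
      rw [← lp.single_smul, ← lp.single_add]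
      congr 1
      push_cast
      rw [zpow_add_one₀ ha0, zpow_sub_one₀ ha0, smul_eq_mul]
      ring
    rw [hopOp_single, h3]
    simp only [g]
    rw [h1, h2, sub_add_cancel]
    abel
  rw [h]
  exact (norm_sub_le _ _).trans (by linarith [hg N, hg 0])

/-- If `d n → 0` as `n → -∞`, the spectrum contains `2 cos θ`. -/
theorem add_inv_mem_spectrumPMap_jacobiOp (hd : Tendsto d atBot (𝓝 0)) {a : ℂ} (ha : ‖a‖ = 1) :
    a + a⁻¹ ∈ spectrumPMap (jacobiOp d) := by
  rintro ⟨R, -, hR⟩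
  -- With `‖R‖ δ ≤ 1/2` the potential's share is absorbed, leaving `‖x‖ ≤ 8‖R‖`; a large `N`
  -- contradicts this.
  obtain ⟨δ, hδ, hRδ⟩ : ∃ δ : ℝ, 0 < δ ∧ ‖R‖ * δ ≤ 1 / 2 := by
    refine ⟨1 / (2 * (‖R‖ + 1)), by positivity, ?_⟩
    rw [mul_one_div, div_le_div_iff₀ (by positivity) (by norm_num)]
    linarith
  obtain ⟨m, hm⟩ : ∃ m : ℤ, ∀ n ≤ m, |d n| ≤ δ := by
    obtain ⟨m, hm⟩ := eventually_atBot.mp (Metric.tendsto_nhds.mp hd δ hδ)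
    exact ⟨m, fun n hn => by simpa using (hm n hn).le⟩
  obtain ⟨N, hN⟩ := exists_nat_gt ((8 * ‖R‖) ^ 2)
  set x := planeWave a m N with hx
  let X : (jacobiOp d).domain := ⟨x, planeWave_mem_domain a m N⟩
  have hdiag : ‖diagOp d X‖ ≤ δ * ‖x‖ := by
    have h1 : ‖diagOp d X‖ ≤ ‖(δ : ℂ) • x‖ := by
      refine lp.norm_mono (by norm_num) fun n => ?_
      change ‖(d n : ℂ) * x n‖ ≤ ‖(δ : ℂ) * x n‖
      rcases lt_or_ge m n with hn | hn
      · rw [hx, planeWave_apply_eq_zero a N hn]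
        simp
      · rw [norm_mul, norm_mul, Complex.norm_real, Complex.norm_real, Real.norm_eq_abs,
          Real.norm_of_nonneg hδ.le]
        gcongr
        exact hm n hn
    rwa [norm_smul, Complex.norm_real, Real.norm_of_nonneg hδ.le] at h1
  have h1 : ‖jacobiOp d X - (a + a⁻¹) • x‖ ≤ 4 + δ * ‖x‖ := by
    have h2 : jacobiOp d X - (a + a⁻¹) • x = (hopOp x - (a + a⁻¹) • x) + diagOp d X := by
      rw [jacobiOp_eq]
      abel
    rw [h2]
    exact (norm_add_le _ _).trans (add_le_add (norm_hopOp_planeWave_sub_le ha m N) hdiag)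
  have h2 : ‖x‖ ≤ ‖R‖ * (4 + δ * ‖x‖) := by
    calc ‖x‖ = ‖R (jacobiOp d X - (a + a⁻¹) • x)‖ := by rw [hR X]
      _ ≤ ‖R‖ * ‖jacobiOp d X - (a + a⁻¹) • x‖ := R.le_opNorm _
      _ ≤ _ := by gcongr
  have h3 : ‖x‖ ≤ 8 * ‖R‖ := by
    have := mul_le_mul_of_nonneg_right hRδ (norm_nonneg x)
    nlinarith
  have h4 := norm_planeWave ha m N
  rw [← hx] at h4
  have h5 : ‖x‖ ^ 2 ≤ (8 * ‖R‖) ^ 2 := by gcongr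
  linarith

theorem Icc_subset_spectrumPMap_jacobiOp (hd : Tendsto d atBot (𝓝 0)) :
    (fun x : ℝ => (x : ℂ)) '' Set.Icc (-2) 2 ⊆ spectrumPMap (jacobiOp d) := by
  rintro _ ⟨t, ht, rfl⟩
  have h1 : Complex.exp (Real.arccos (t / 2) * Complex.I) +
      (Complex.exp (Real.arccos (t / 2) * Complex.I))⁻¹ = t := by
    rw [← Complex.exp_neg, ← neg_mul, ← Complex.two_cos, ← Complex.ofReal_cos,
      Real.cos_arccos (by linarith [ht.1]) (by linarith [ht.2])]
    push_cast
    ring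
  have h2 := add_inv_mem_spectrumPMap_jacobiOp hd
    (Complex.norm_exp_ofReal_mul_I (Real.arccos (t / 2)))
  rwa [h1] at h2

/-! ### Assembly, and the potential `α q⁻ⁿ`. -/

/-- The essential spectrum of a Jacobi operator whose potential tends to zero at `-∞`, and whose
potential avoids the `2 + c`-neighbourhood of each real `t` with `|t| > 2` off a finite set. -/
theorem essSpectrumPMap_jacobiOp (hd : Tendsto d atBot (𝓝 0))
    (hfar : ∀ t : ℝ, 2 < |t| → ∃ c > 0, ∃ F : Finset ℤ, ∀ n ∉ F, 2 + c ≤ |d n - t|) :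
    essSpectrumPMap (jacobiOp d) = (fun x : ℝ => (x : ℂ)) '' Set.Icc (-2) 2 := by
  refine Set.Subset.antisymm ?_ fun z hz => Or.inl ?_
  · rintro z (hz | hz)
    · have hreal : z.im = 0 := by
        have hcl : IsClosed {w : ℂ | w.im = 0} :=
          isClosed_eq Complex.continuous_im continuous_const
        have h1 : z ∈ closure (spectrumPMap (jacobiOp d)) :=
          mem_closure_iff_clusterPt.mpr hz.clusterPt
        exact closure_minimal (fun w hw => im_eq_zero_of_mem_spectrumPMap_jacobiOp hw) hcl h1
      obtain ⟨t, rfl⟩ : ∃ t : ℝ, (t : ℂ) = z := ⟨z.re, Complex.ext rfl (by simp [hreal])⟩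
      refine ⟨t, abs_le.mp ?_, rfl⟩
      by_contra! ht
      obtain ⟨c, hc, F, hF⟩ := hfar t ht
      exact not_accPt_spectrumPMap_jacobiOp hc hF hz
    · exact absurd (finiteDimensional_eigenspacePMap_jacobiOp z) hz
  · have hpre : Preperfect ((fun x : ℝ => (x : ℂ)) '' Set.Icc (-2) 2) := by
      refine IsPreconnected.preperfect_of_nontrivial
        ⟨_, ⟨-2, by norm_num, rfl⟩, _, ⟨2, by norm_num, rfl⟩, ?_⟩
        (isPreconnected_Icc.image _ Complex.continuous_ofReal.continuousOn)
      intro h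
      have := Complex.ofReal_injective h
      norm_num at this
    exact (hpre z hz).mono (principal_mono.mpr (Icc_subset_spectrumPMap_jacobiOp hd))

end

theorem zpow_neg_eq_exp {q : ℝ} (hq0 : 0 < q) (n : ℤ) :
    q ^ (-n) = Real.exp (n * -Real.log q) := by
  rw [← Real.rpow_intCast, Real.rpow_def_of_pos hq0]
  push_cast
  ring_nf

theorem tendsto_zpow_neg_atBot {q : ℝ} (hq0 : 0 < q) (hq1 : q < 1) :
    Tendsto (fun n : ℤ => q ^ (-n)) atBot (𝓝 0) := by
  simp only [zpow_neg_eq_exp hq0]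
  exact Real.tendsto_exp_atBot.comp
    ((tendsto_intCast_atBot_iff.mpr tendsto_id).atBot_mul_const (neg_pos.mpr (Real.log_neg hq0 hq1)))

theorem tendsto_zpow_neg_atTop {q : ℝ} (hq0 : 0 < q) (hq1 : q < 1) :
    Tendsto (fun n : ℤ => q ^ (-n)) atTop atTop := by
  simp only [zpow_neg_eq_exp hq0]
  exact Real.tendsto_exp_atTop.comp
    (tendsto_intCast_atTop_atTop.atTop_mul_const (neg_pos.mpr (Real.log_neg hq0 hq1)))

theorem exists_finset_forall_notMem_le_abs_sub {q : ℝ} (hq0 : 0 < q) (hq1 : q < 1) (α : ℝ) {t : ℝ}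
    (ht : 2 < |t|) :
    ∃ c > 0, ∃ F : Finset ℤ, ∀ n ∉ F, 2 + c ≤ |α * q ^ (-n) - t| := by
  -- Half the gap: `2 + c` stays strictly below `|t|`, the limit of `|d n - t|` at `-∞`.
  refine ⟨(|t| - 2) / 2, by linarith, ?_⟩
  have hbot : ∀ᶠ n : ℤ in atBot, 2 + (|t| - 2) / 2 ≤ |α * q ^ (-n) - t| := by
    have h1 : Tendsto (fun n : ℤ => |α * q ^ (-n) - t|) atBot (𝓝 |α * 0 - t|) :=
      (((tendsto_zpow_neg_atBot hq0 hq1).const_mul α).sub_const t).abs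
    rw [mul_zero, zero_sub, abs_neg] at h1
    exact h1.eventually_const_le (by linarith)
  have htop : ∀ᶠ n : ℤ in atTop, 2 + (|t| - 2) / 2 ≤ |α * q ^ (-n) - t| := by
    rcases eq_or_ne α 0 with rfl | hα
    · refine Eventually.of_forall fun n => ?_
      rw [zero_mul, zero_sub, abs_neg]
      linarith
    · have h1 : Tendsto (fun n : ℤ => |α| * q ^ (-n)) atTop atTop :=
        (tendsto_zpow_neg_atTop hq0 hq1).const_mul_atTop (abs_pos.mpr hα)
      filter_upwards [h1.eventually_ge_atTop (2 + (|t| - 2) / 2 + |t|)] with n hn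
      have h2 := abs_sub_abs_le_abs_sub (α * q ^ (-n)) t
      rw [abs_mul, abs_of_pos (zpow_pos hq0 (-n))] at h2
      linarith
  obtain ⟨a, ha⟩ := eventually_atBot.mp hbot
  obtain ⟨b, hb⟩ := eventually_atTop.mp htop
  refine ⟨Finset.Icc a b, fun n hn => ?_⟩
  rw [Finset.mem_Icc, not_and_or, not_le, not_le] at hn
  exact hn.elim (fun h => ha n h.le) fun h => hb n h.le

end

theorem mainTheorem6 (q : ℝ) (hq0 : 0 < q) (hq1 : q < 1) (α : ℝ) :
    essSpectrumPMap (opB α q) = (fun x : ℝ => (x : ℂ)) '' Set.Icc (-2) 2 := by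
  rw [opB_eq_jacobiOp]
  refine essSpectrumPMap_jacobiOp ?_ fun t ht =>
    exists_finset_forall_notMem_le_abs_sub hq0 hq1 α ht
  simpa using (tendsto_zpow_neg_atBot hq0 hq1).const_mul α
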